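/- **Model.** Consider the two-stage robust program $$w^*=\min_{x\in\mathcal X} c_1x+\max_{u\in\mathcal U(x)}\ \min_{y\in\mathcal Y(x,u)}c_2y,$$ where $\mathcal X=\{x\in\mathbb R^{n_x}_+\times\mathbb Z^{m_x}_+: Ax\ge b\}$, $\mathbb U_d\subset\mathbb Z_+^{m_u}$ is finite, $\mathcal U(x)=\{(u_c,u_d)\in\mathbb R_+^{n_u}\times\mathbb U_d: F_cu_c+F_du_d\le h+Gx\}$ has $\mu_u$ constraints and depends on $x$ only through the right-hand side, and $\mathcal Y(x,u)=\{y\in\mathbb R_+^{n_y}: B_2y\ge d-B_1x-E_cu_c-E_du_d\}$ has $\mu_y$ constraints. Assume that for every $x\in\mathcal X$ the set $\mathcal U(x)$ is nonempty and bounded, and that $c_1x+c_2y$ is bounded below over $x\in\mathcal X$, $u\in\mathcal U(x)$, $y\in\mathcal Y(x,u)$. Write $\mathcal U(x|u_d)=\{u_c\ge 0: F_cu_c\le h+Gx-F_du_d\}$. Let $\Pi=\{\pi\ge0: B_2^\top\pi\le c_2^\top\}$, let $\mathcal P_\Pi$ be its set of extreme points and $\mathcal R_\Pi$ the set of its extreme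 rays (extreme rays of $\{\gamma\ge 0:B_2^\top\gamma\le0\}$), each normalized to coordinate sum $1$. For $M\in\mathbb R$, let $\mathbf{LP}(x,u_d,\beta)$ be $$\max\{-(E_cu_c)^\top\beta-M\mathbf 1^\top\tilde u:\ F_cu_c-\tilde u\le h+Gx-F_du_d,\ u_c\ge0,\ \tilde u\ge0\},$$ and let $\mathcal{OU}(x,u_d,\beta)$ be the set of $(u_c,\tilde u,\lambda)$ satisfying its KKT conditions. The *uniqueness property* says that $\mathbf{LP}(x,u_d,\beta)$ has exactly one optimal solution $(u_c,\tilde u)$ for all $x\in\mathcal X$, $u_d\in\mathbb U_d$, $\beta\in\mathcal P_\Pi\cup\mathcal R_\Pi$. **Algorithm (parametric C&CG-MIU**, empty initial cut set, tolerance $0$, unified cutting sets). Put $UB=+\infty$ and $S=\emptyset$. In each iteration: (1) solve the master problem: minimize $c_1x+\eta$ over $x\in\mathcal X$, $\eta\in\mathbb R$ such that for every $(u_d,\beta)\in S$ there are $(u_c,\tilde u,\lambda)\in\mathcal{OU}(x,u_d,\beta)$ and $y\ge0$ with either $\tilde u\ne0$, or $\tilde u=0$, $\eta\ge c_2y$ and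 $y\in\mathcal Y(x,(u_c,u_d))$. If it is infeasible, stop; otherwise let $LB\in[-\infty,\infty)$ be its value and $x^t$ an optimal $x$ (if $LB=-\infty$: an $x$ for which $\eta$ is unbounded below). (2) Let $$\eta_f(x^t)=\max_{u\in\mathcal U(x^t)}\min\{\mathbf 1^\top\tilde y:B_2y+\tilde y\ge d-B_1x^t-E_cu_c-E_du_d,\ y,\tilde y\ge0\}.\quad(\mathbf{SP1})$$ If $\eta_f(x^t)=0$, let $(u^t_c,u^t_d)$ be any optimal scenario of $$\eta_o(x^t)=\max_{u\in\mathcal U(x^t)}\min_{y\in\mathcal Y(x^t,u)}c_2y\quad(\mathbf{SP2})$$ and $\beta^t\in\mathcal P_\Pi$ an optimal dual solution of its recourse problem. If $\eta_f(x^t)>0$, let $(u^t_c,u^t_d)$ be any optimal scenario of $\mathbf{SP1}$ and $\beta^t\in\mathcal R_\Pi$ with $(d-B_1x^t-E_cu^t_c-E_du^t_d)^\top\beta^t>0$, and put $\eta_o(x^t)=+\infty$. Add $(u_d^t,\beta^t)$ to $S$. (3) Put $UB\leftarrow\min\{UB,\,c_1x^t+\eta_o(x^t)\}$; stop if $UB\le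 LB$, otherwise start the next iteration. **Bases.** A basis of $\mathcal U(x|u_d)$ is a set $\mathbb B$ of $\mu_u$ linearly independent columns of $[F_c\ I]$ (constraints written as $F_cu_c+s=h+Gx-F_du_d$, $u_c,s\ge0$). It is an *optimal basis* of $\mathbf{LP}(x,u_d,\beta)$ if its basic solution is feasible and the reduced costs with respect to $\mathbb B$ of all columns of $\mathbf{LP}(x,u_d,\beta)$ (those of $u_c$, $s$ and $\tilde u$) have the optimal sign. A basis is *associated with iteration $t$* if it is an optimal basis of $\mathbf{LP}(x^t,u_d^t,\beta^t)$. **Theorem.** For all sufficiently large $M$ (depending only on the data of the program), if the uniqueness property holds, then for every execution of the algorithm: 1. Every performed iteration $t$ has an associated basis. If $\eta_f(x^t)=0$, the $u_c$-part of the basic solution of every associated basis is the scenario $u_c^t$ found by $\mathbf{SP2}$. 2. If $t_1<t_2$, $u_d^{t_1}=u_d^{t_2}$, and some basis $\mathbb B$ associated with iteration $t_1$ is associated with iteration $t_2$, or is a basis of $\mathcal U(x^{t_2}|u_d^{t_2})$ whose basic solution is feasible with $u_c$-part $u_c^{t_2}$, then the algorithm terminates in iteration $t_2$. 3. The number $N$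 of iterations performed before the one in which the algorithm terminates satisfies $N\le|\mathbb U_d|\binom{n_u+\mu_u}{\mu_u}$, and moreover $$N\le\min\Big\{|\mathbb U_d|\,(|\mathcal P_\Pi|+|\mathcal R_\Pi|),\ |\mathcal X|,\ |\mathbb U_d|\tbinom{n_u+\mu_u}{\mu_u}\Big\},\qquad N\le\min\Big\{|\mathbb U_d|\tbinom{n_y+\mu_y+1}{\mu_y},\ |\mathcal X|,\ |\mathbb U_d|\tbinom{n_u+\mu_u}{\mu_u}\Big\},$$ where $|\mathcal X|=\infty$ if $\mathcal X$ is infinite. -/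

import Mathlib

open Matrix

/-- Data of a two-stage robust program
`min_{x ∈ X} c1 x + max_{u ∈ U(x)} min_{y ∈ Y(x,u)} c2 y`
with a mixed-integer, right-hand-side decision-dependent uncertainty set and a linear recourse problem.
`nx, mx`: numbers of continuous / integer first-stage variables, `kx` first-stage constraints;
`nu, mu`: numbers of continuous / discrete uncertainty variables, `ku` constraints of `U(x)`;
`ny` recourse variables, `ky` recourse constraints.
`Ud` is the (bounded, hence finite) set of discrete scenarios in `ℤ₊^mu`. -/
structure TwoStageRO (nx mx kx nu mu ku ny ky : ℕ) where
  A : Matrix (Fin kx) (Fin nx ⊕ Fin mx) ℝ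
  b : Fin kx → ℝ
  c1 : Fin nx ⊕ Fin mx → ℝ
  Fc : Matrix (Fin ku) (Fin nu) ℝ
  Fd : Matrix (Fin ku) (Fin mu) ℝ
  h : Fin ku → ℝ
  G : Matrix (Fin ku) (Fin nx ⊕ Fin mx) ℝ
  Ud : Finset (Fin mu → ℕ)
  B1 : Matrix (Fin ky) (Fin nx ⊕ Fin mx) ℝ
  B2 : Matrix (Fin ky) (Fin ny) ℝ
  Ec : Matrix (Fin ky) (Fin nu) ℝ
  Ed : Matrix (Fin ky) (Fin mu) ℝ
  d : Fin ky → ℝ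
  c2 : Fin ny → ℝ

/-- What an execution of the algorithm records in each iteration `t = 0, 1, 2, …`:
the first-stage solution, the worst-case scenario `(uc, ud)`, and the extreme point or ray `beta`. -/
structure Trajectory (nx mx nu mu ky : ℕ) where
  x : ℕ → (Fin nx ⊕ Fin mx → ℝ)
  uc : ℕ → (Fin nu → ℝ)
  ud : ℕ → (Fin mu → ℕ)
  beta : ℕ → (Fin ky → ℝ)

namespace TwoStageRO

variable {nx mx kx nu mu ku ny ky : ℕ} (P : TwoStageRO nx mx kx nu mu ku ny ky)

/-! ### The two-stage model -/

/-- The first-stage set `X = {x ∈ ℝ₊^nx × ℤ₊^mx : A x ≥ b}`. -/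
def X : Set (Fin nx ⊕ Fin mx → ℝ) :=
  {x | 0 ≤ x ∧ (∀ j : Fin mx, ∃ z : ℤ, x (Sum.inr j) = z) ∧ P.b ≤ P.A *ᵥ x}

/-- The right-hand side `h + G x - Fd ud` of the constraints on the continuous scenario. -/
def rhs (x : Fin nx ⊕ Fin mx → ℝ) (ud : Fin mu → ℕ) : Fin ku → ℝ :=
  P.h + P.G *ᵥ x - P.Fd *ᵥ (fun j => (ud j : ℝ))

/-- The slice `U(x | ud) = {uc ≥ 0 : Fc uc ≤ h + G x - Fd ud}`. -/
def USlice (x : Fin nx ⊕ Fin mx → ℝ) (ud : Fin mu → ℕ) : Set (Fin nu → ℝ) :=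
  {uc | 0 ≤ uc ∧ P.Fc *ᵥ uc ≤ P.rhs x ud}

/-- The decision-dependent uncertainty set `U(x)`. -/
def U (x : Fin nx ⊕ Fin mx → ℝ) : Set ((Fin nu → ℝ) × (Fin mu → ℕ)) :=
  {u | u.2 ∈ P.Ud ∧ u.1 ∈ P.USlice x u.2}

/-- The right-hand side `d - B1 x - Ec uc - Ed ud` of the recourse constraints. -/
def demand (x : Fin nx ⊕ Fin mx → ℝ) (uc : Fin nu → ℝ) (ud : Fin mu → ℕ) : Fin ky → ℝ :=
  P.d - P.B1 *ᵥ x - P.Ec *ᵥ uc - P.Ed *ᵥ (fun j => (ud j : ℝ))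

/-- The recourse feasible set `Y(x, u)`. -/
def Y (x : Fin nx ⊕ Fin mx → ℝ) (uc : Fin nu → ℝ) (ud : Fin mu → ℕ) : Set (Fin ny → ℝ) :=
  {y | 0 ≤ y ∧ P.demand x uc ud ≤ P.B2 *ᵥ y}

/-- Every first-stage decision admits a scenario. -/
def AssumptionA1 : Prop := ∀ x ∈ P.X, (P.U x).Nonempty

/-- Every uncertainty set `U(x)`, `x ∈ X`, is bounded. -/
def AssumptionA2 : Prop := ∀ x ∈ P.X, ∃ C : ℝ, ∀ u ∈ P.U x, ∀ j, u.1 j ≤ C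

/-- The monolithic program `min {c1 x + c2 y : x ∈ X, u ∈ U(x), y ∈ Y(x,u)}` is bounded below. -/
def AssumptionA3 : Prop :=
  BddBelow {w : ℝ | ∃ x ∈ P.X, ∃ u ∈ P.U x, ∃ y ∈ P.Y x u.1 u.2,
    w = P.c1 ⬝ᵥ x + P.c2 ⬝ᵥ y}

/-! ### The dual polyhedron of the recourse problem -/

/-- The dual feasible set `Π = {π ≥ 0 : B2ᵀ π ≤ c2}`. -/
def dualSet : Set (Fin ky → ℝ) := {p | 0 ≤ p ∧ P.B2ᵀ *ᵥ p ≤ P.c2}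

/-- The recession cone `{γ ≥ 0 : B2ᵀ γ ≤ 0}` of `Π`. -/
def dualCone : Set (Fin ky → ℝ) := {g | 0 ≤ g ∧ P.B2ᵀ *ᵥ g ≤ 0}

/-- The extreme points of `Π`. -/
def extrPoints : Set (Fin ky → ℝ) := Set.extremePoints ℝ P.dualSet

/-- The extreme rays of `Π`, each represented by its generator with coordinate sum `1`. -/
def extrRays : Set (Fin ky → ℝ) :=
  {g | g ∈ P.dualCone ∧ ∑ i, g i = 1 ∧
    ∀ a ∈ P.dualCone, ∀ c ∈ P.dualCone, a + c = g → ∃ s : ℝ, a = s • g}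

/-! ### The penalized linear program `LP(x, ud, beta)` -/

/-- Feasible points `(uc, ut)` of `LP(x, ud, beta)`; `ut` is the vector of artificial variables. -/
def lpFeasible (x : Fin nx ⊕ Fin mx → ℝ) (ud : Fin mu → ℕ) :
    Set ((Fin nu → ℝ) × (Fin ku → ℝ)) :=
  {p | 0 ≤ p.1 ∧ 0 ≤ p.2 ∧ P.Fc *ᵥ p.1 - p.2 ≤ P.rhs x ud}

/-- The objective `(-Ec uc)ᵀ beta - M 1ᵀ ut` of `LP(x, ud, beta)`. -/
def lpObj (M : ℝ) (beta : Fin ky → ℝ) (p : (Fin nu → ℝ) × (Fin ku → ℝ)) : ℝ :=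
  (-(P.Ec *ᵥ p.1)) ⬝ᵥ beta - M * ∑ i, p.2 i

/-- The optimal solutions `(uc, ut)` of `LP(x, ud, beta)`. -/
def lpOptimal (M : ℝ) (x : Fin nx ⊕ Fin mx → ℝ) (ud : Fin mu → ℕ) (beta : Fin ky → ℝ) :
    Set ((Fin nu → ℝ) × (Fin ku → ℝ)) :=
  {p | p ∈ P.lpFeasible x ud ∧ ∀ q ∈ P.lpFeasible x ud, P.lpObj M beta q ≤ P.lpObj M beta p}

/-- The uniqueness property: each `LP(x, ud, beta)` with `x ∈ X`, `ud ∈ Ud` and `beta` an extreme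
point or extreme ray of `Π` has exactly one optimal solution. -/
def Uniqueness (M : ℝ) : Prop :=
  ∀ x ∈ P.X, ∀ ud ∈ P.Ud, ∀ beta ∈ P.extrPoints ∪ P.extrRays,
    ∃! p : (Fin nu → ℝ) × (Fin ku → ℝ), p ∈ P.lpOptimal M x ud beta

/-- The set `OU(x, ud, beta)`: triples `(uc, ut, lam)` satisfying the KKT conditions of
`LP(x, ud, beta)`. -/
def OU (M : ℝ) (x : Fin nx ⊕ Fin mx → ℝ) (ud : Fin mu → ℕ) (beta : Fin ky → ℝ) :
    Set ((Fin nu → ℝ) × (Fin ku → ℝ) × (Fin ku → ℝ)) :=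
  {p | P.Fc *ᵥ p.1 - p.2.1 ≤ P.rhs x ud ∧
    -(P.Ecᵀ *ᵥ beta) ≤ P.Fcᵀ *ᵥ p.2.2 ∧ (∀ i, p.2.2 i ≤ M) ∧
    (∀ i, p.2.2 i * (P.rhs x ud - P.Fc *ᵥ p.1 + p.2.1) i = 0) ∧
    (∀ j, p.1 j * (P.Fcᵀ *ᵥ p.2.2 + P.Ecᵀ *ᵥ beta) j = 0) ∧
    (∀ i, p.2.1 i * (M - p.2.2 i) = 0) ∧
    0 ≤ p.1 ∧ 0 ≤ p.2.1 ∧ 0 ≤ p.2.2}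

/-! ### Bases of `U(x | ud)` -/

/-- The constraint matrix `[Fc I]` of `U(x | ud)` in equality form `Fc uc + s = h + G x - Fd ud`,
`uc ≥ 0`, `s ≥ 0`; columns `inl j` belong to `uc`, columns `inr i` to the slacks `s`. -/
def tableau : Matrix (Fin ku) (Fin nu ⊕ Fin ku) ℝ := Matrix.fromCols P.Fc 1

/-- A basis: `ku` linearly independent columns of `[Fc I]`. -/
def IsBasis (B : Finset (Fin nu ⊕ Fin ku)) : Prop :=
  B.card = ku ∧ LinearIndependent ℝ (fun j : B => fun i => P.tableau i j)

/-- `B` is a basis of `U(x | ud)` whose basic solution is feasible and has `uc` as its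
`uc`-component. -/
def IsBasisFor (x : Fin nx ⊕ Fin mx → ℝ) (ud : Fin mu → ℕ) (B : Finset (Fin nu ⊕ Fin ku))
    (uc : Fin nu → ℝ) : Prop :=
  P.IsBasis B ∧ ∃ s : Fin ku → ℝ, 0 ≤ uc ∧ 0 ≤ s ∧ P.Fc *ᵥ uc + s = P.rhs x ud ∧
    (∀ j, Sum.inl j ∉ B → uc j = 0) ∧ (∀ i, Sum.inr i ∉ B → s i = 0)

/-- `B` is an optimal basis of `LP(x, ud, beta)` containing no artificial column: its basic solution
is feasible, and all reduced costs (of the columns of `uc`, of the slacks, and of the artificial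
variables) have the optimal sign, `lam` being the simplex multipliers of `B`. -/
def IsOptimalBasis (M : ℝ) (x : Fin nx ⊕ Fin mx → ℝ) (ud : Fin mu → ℕ) (beta : Fin ky → ℝ)
    (B : Finset (Fin nu ⊕ Fin ku)) : Prop :=
  (∃ uc, P.IsBasisFor x ud B uc) ∧
  ∃ lam : Fin ku → ℝ,
    (∀ j, Sum.inl j ∈ B → (P.Fcᵀ *ᵥ lam) j = (-(P.Ecᵀ *ᵥ beta)) j) ∧
    (∀ i, Sum.inr i ∈ B → lam i = 0) ∧
    -(P.Ecᵀ *ᵥ beta) ≤ P.Fcᵀ *ᵥ lam ∧ 0 ≤ lam ∧ (∀ i, lam i ≤ M)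

/-! ### The master problem -/

/-- `(x, η)` satisfies the (unified) cutting set of `(ud, beta)`: for some
`(uc, ut, ·) ∈ OU(x, ud, beta)` and `y ≥ 0`, `η ≥ c2 y - δ(ut)` and
`B2 y + Ec uc + δ(ut) ≥ d - B1 x - Ed ud`, where `δ(0) = 0` and `δ(ut) = +∞` for `ut ≠ 0`, so that
both inequalities hold trivially when `ut ≠ 0`. -/
def SatisfiesCut (M : ℝ) (c : (Fin mu → ℕ) × (Fin ky → ℝ)) (x : Fin nx ⊕ Fin mx → ℝ) (η : ℝ) :
    Prop :=
  ∃ q ∈ P.OU M x c.1 c.2, ∃ y : Fin ny → ℝ, 0 ≤ y ∧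
    (q.2.1 = 0 → P.c2 ⬝ᵥ y ≤ η ∧ P.demand x q.1 c.1 ≤ P.B2 *ᵥ y)

/-- Feasible `(x, η)` of the master problem with the set `S` of stored pairs `(ud, beta)`. -/
def MPFeasible (M : ℝ) (S : Set ((Fin mu → ℕ) × (Fin ky → ℝ))) (x : Fin nx ⊕ Fin mx → ℝ) (η : ℝ) :
    Prop :=
  x ∈ P.X ∧ ∀ c ∈ S, P.SatisfiesCut M c x η

/-- The value of the master problem for fixed `x` (`⊤` if infeasible, `⊥` if unbounded). -/
noncomputable def mpValue (M : ℝ) (S : Set ((Fin mu → ℕ) × (Fin ky → ℝ)))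
    (x : Fin nx ⊕ Fin mx → ℝ) : EReal :=
  ⨅ (η : ℝ) (_ : P.MPFeasible M S x η), ((P.c1 ⬝ᵥ x + η : ℝ) : EReal)

/-- The master problem is feasible and `x` is (the first-stage part of) an optimal solution; when the
value is `-∞`, this means that the value is `-∞` already with this `x` fixed. -/
def MPOptimal (M : ℝ) (S : Set ((Fin mu → ℕ) × (Fin ky → ℝ))) (x : Fin nx ⊕ Fin mx → ℝ) : Prop :=
  (∃ η, P.MPFeasible M S x η) ∧ ∀ x' ∈ P.X, P.mpValue M S x ≤ P.mpValue M S x'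

/-! ### The subproblems -/

/-- Inner problem of `SP1`: `min {1ᵀ yt : B2 y + yt ≥ d - B1 x - Ec uc - Ed ud, y ≥ 0, yt ≥ 0}`. -/
noncomputable def infeasibility (x : Fin nx ⊕ Fin mx → ℝ) (uc : Fin nu → ℝ) (ud : Fin mu → ℕ) :
    EReal :=
  ⨅ (y : Fin ny → ℝ) (yt : Fin ky → ℝ)
    (_ : 0 ≤ y ∧ 0 ≤ yt ∧ P.demand x uc ud ≤ P.B2 *ᵥ y + yt), ((∑ i, yt i : ℝ) : EReal)

/-- Inner problem of `SP2`: the recourse value `min {c2 y : y ∈ Y(x, u)}` (`⊤` if infeasible). -/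
noncomputable def recourseValue (x : Fin nx ⊕ Fin mx → ℝ) (uc : Fin nu → ℝ) (ud : Fin mu → ℕ) :
    EReal :=
  ⨅ (y : Fin ny → ℝ) (_ : y ∈ P.Y x uc ud), ((P.c2 ⬝ᵥ y : ℝ) : EReal)

/-- The value `η_f(x)` of `SP1`. -/
noncomputable def etaF (x : Fin nx ⊕ Fin mx → ℝ) : EReal :=
  ⨆ u ∈ P.U x, P.infeasibility x u.1 u.2

/-- The worst-case recourse value `η_o(x)` of `SP2` (equal to `⊤` when `x` is infeasible). -/
noncomputable def etaO (x : Fin nx ⊕ Fin mx → ℝ) : EReal :=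
  ⨆ u ∈ P.U x, P.recourseValue x u.1 u.2

/-- Outcome of the subproblems in case `η_f(x) = 0`: `(uc, ud)` is an optimal scenario of `SP2` and
`beta` is an extreme point of `Π` that is an optimal dual solution of its recourse problem. -/
def OptimalityCase (x : Fin nx ⊕ Fin mx → ℝ) (uc : Fin nu → ℝ) (ud : Fin mu → ℕ)
    (beta : Fin ky → ℝ) : Prop :=
  P.etaF x = 0 ∧ (uc, ud) ∈ P.U x ∧ P.recourseValue x uc ud = P.etaO x ∧
    beta ∈ P.extrPoints ∧ ∀ p ∈ P.dualSet, P.demand x uc ud ⬝ᵥ p ≤ P.demand x uc ud ⬝ᵥ beta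

/-- Outcome of the subproblems in case `η_f(x) > 0`: `(uc, ud)` is an optimal scenario of `SP1` and
`beta` is an extreme ray of `Π` along which `SP3`, i.e. `max {(d - B1 x - Ec uc - Ed ud)ᵀ π : π ∈ Π}`,
is unbounded. -/
def FeasibilityCase (x : Fin nx ⊕ Fin mx → ℝ) (uc : Fin nu → ℝ) (ud : Fin mu → ℕ)
    (beta : Fin ky → ℝ) : Prop :=
  0 < P.etaF x ∧ (uc, ud) ∈ P.U x ∧ P.infeasibility x uc ud = P.etaF x ∧
    beta ∈ P.extrRays ∧ 0 < P.demand x uc ud ⬝ᵥ beta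

/-! ### The algorithm parametric C&CG-MIU (empty initial cut set, tolerance zero) -/

/-- The pairs `(ud, beta)` stored at the beginning of iteration `t`. -/
def cuts (T : Trajectory nx mx nu mu ky) (t : ℕ) : Set ((Fin mu → ℕ) × (Fin ky → ℝ)) :=
  {c | ∃ s < t, c = (T.ud s, T.beta s)}

/-- In iteration `t` the master problem is feasible, `T.x t` solves it, and the scenario and extreme
point or ray recorded by `T` are obtained from the subproblems at `T.x t`. -/
def Performs (M : ℝ) (T : Trajectory nx mx nu mu ky) (t : ℕ) : Prop :=
  P.MPOptimal M (cuts T t) (T.x t) ∧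
    (P.OptimalityCase (T.x t) (T.uc t) (T.ud t) (T.beta t) ∨
      P.FeasibilityCase (T.x t) (T.uc t) (T.ud t) (T.beta t))

/-- The lower bound `LB` after iteration `t`. -/
noncomputable def LB (M : ℝ) (T : Trajectory nx mx nu mu ky) (t : ℕ) : EReal :=
  P.mpValue M (cuts T t) (T.x t)

/-- The upper bound `UB` after iteration `t`. -/
noncomputable def UB (T : Trajectory nx mx nu mu ky) (t : ℕ) : EReal :=
  ⨅ s ∈ Set.Iic t, ((P.c1 ⬝ᵥ T.x s : ℝ) : EReal) + P.etaO (T.x s)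

/-- The termination test `UB - LB ≤ 0` succeeds at the end of iteration `t`. -/
def TerminatesAt (M : ℝ) (T : Trajectory nx mx nu mu ky) (t : ℕ) : Prop :=
  P.UB T t ≤ P.LB M T t

/-- The first `N` iterations `0, …, N-1` are carried out and the algorithm does not terminate in any
of them. -/
def RunsThrough (M : ℝ) (T : Trajectory nx mx nu mu ky) (N : ℕ) : Prop :=
  ∀ t < N, P.Performs M T t ∧ ¬ P.TerminatesAt M T t

end TwoStageRO

/-! The first-stage decision enters `LP(x, ud, beta)` only through its right-hand side, so the sign
conditions on the reduced costs of a basis depend on `beta` but not on `x`. A basis optimal in an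
earlier iteration is therefore again optimal for that iteration's cut wherever its basic solution is
feasible. Uniqueness then makes this basic solution the only scenario the cut admits and closes the
escape `ut ≠ 0`.

If the enforced scenario is the worst case of `SP2`, the master value is at least `c1 x + etaO x`,
hence at least `UB`; if its recourse problem is infeasible, the master would be infeasible at its
own solution. This is `terminatesAt_of_cut`. An optimal basis at the current iterate always enforces
one of the two (`reproduces_of_basis`). Hence repeating `(ud, B)`, `(ud, beta)` or `x` forces
termination, and the bounds count these keys.

Associated bases exist by LP duality, after moving the primal solution to independent support and
the dual solution to a vertex (`exists_basis_of_nonempty`). `M` need only dominate the finitely many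
multiplier vectors of pairs (`beta`, basis). -/

/-! ### Finitely generated cones. -/

/-- The simplex ratio test: `t` is the minimum of `a j / (-d j)` over `d j < 0`. -/
theorem exists_ratio {ι : Type*} [Fintype ι] (a d : ι → ℝ) (ha : ∀ j, 0 ≤ a j)
    (hd : ∃ j, d j < 0) :
    ∃ t : ℝ, (∀ j, 0 ≤ a j + t * d j) ∧ ∃ j, d j < 0 ∧ a j + t * d j = 0 := by
  classical
  obtain ⟨j₀, hj₀⟩ := hd
  obtain ⟨i, hi, hmin⟩ := Finset.exists_min_image (Finset.univ.filter fun j => d j < 0)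
    (fun j => a j / (-d j)) ⟨j₀, by simpa using hj₀⟩
  simp only [Finset.mem_filter, Finset.mem_univ, true_and] at hi hmin
  have hi' : 0 < -d i := by linarith
  have ht : 0 ≤ a i / (-d i) := div_nonneg (ha i) hi'.le
  refine ⟨a i / (-d i), fun j => ?_, i, hi, ?_⟩
  · by_cases hj : d j < 0
    · have h := hmin j hj
      rw [le_div_iff₀ (by linarith)] at h
      linarith
    · have := mul_nonneg ht (not_lt.1 hj)
      linarith [ha j]
  · have := hi.ne
    field_simp
    ring

/-- Moving along a linear dependency of the support keeps the sum, and the ratio test kills a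
coefficient. Zeros stay zero, which later preserves complementary slackness. -/
theorem conic_caratheodory {ι E : Type*} [Fintype ι] [AddCommGroup E] [Module ℝ E] (v : ι → E)
    (z : ι → ℝ) (hz : ∀ j, 0 ≤ z j) :
    ∃ z' : ι → ℝ, (∀ j, 0 ≤ z' j) ∧ (∀ j, z j = 0 → z' j = 0) ∧
      ∑ j, z' j • v j = ∑ j, z j • v j ∧ LinearIndepOn ℝ v {j | z' j ≠ 0} := by
  classical
  induction hn : (Finset.univ.filter fun j => z j ≠ 0).card using Nat.strong_induction_on
    generalizing z with
  | _ n ih =>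
    set s := Finset.univ.filter fun j => z j ≠ 0 with hs
    by_cases hli : LinearIndepOn ℝ v (s : Set ι)
    · exact ⟨z, hz, fun _ h => h, rfl, by simpa [hs] using hli⟩
    · rw [linearIndepOn_finset_iff] at hli
      push Not at hli
      obtain ⟨g, hg, i, his, hgi⟩ := hli
      obtain ⟨d, hd, hds, hd0⟩ : ∃ d : ι → ℝ, ∑ j, d j • v j = 0 ∧ (∀ j, z j = 0 → d j = 0) ∧
          ∃ j, d j < 0 := by
        have key : ∀ c : ℝ, ∑ j, (if j ∈ s then c * g j else 0) • v j = 0 := by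
          intro c
          simp only [ite_smul, zero_smul, mul_smul, Finset.sum_ite_mem, Finset.univ_inter]
          rw [← Finset.smul_sum, hg, smul_zero]
        have hsz : ∀ j, z j = 0 → j ∉ s := fun j h => by simp [hs, h]
        -- The sign of the dependency is chosen so that some coefficient is negative.
        rcases lt_or_gt_of_ne hgi with h | h
        · exact ⟨_, key 1, fun j hj => by simp [hsz j hj], i, by simpa [his] using h⟩
        · exact ⟨_, key (-1), fun j hj => by simp [hsz j hj], i, by simpa [his] using h⟩
      obtain ⟨t, ht, k, hk, hk0⟩ := exists_ratio z d hz hd0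
      obtain ⟨z', h1, h2, h3, h4⟩ := ih _ (by
        rw [← hn]
        apply Finset.card_lt_card
        refine ⟨fun j hj => ?_, fun h => ?_⟩
        · simp only [Finset.mem_filter, Finset.mem_univ, true_and, hs] at hj ⊢
          exact fun h => hj (by rw [h, hds j h]; simp)
        · have hks : k ∈ s := by
            simp only [Finset.mem_filter, Finset.mem_univ, true_and, hs]
            exact fun h => by rw [hds k h] at hk; exact lt_irrefl _ hk
          have := h hks
          simp only [Finset.mem_filter, Finset.mem_univ, true_and] at this
          exact this hk0) (fun j => z j + t * d j) ht rfl
      refine ⟨z', h1, fun j hj => h2 j ?_, ?_, h4⟩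
      · simp [hj, hds j hj]
      · rw [h3]
        simp only [add_smul, mul_smul, Finset.sum_add_distrib]
        rw [← Finset.smul_sum, hd, smul_zero, add_zero]

/-- By Carathéodory the cone is a finite union of images of closed orthants under injective linear
maps, which are closed embeddings. -/
theorem isClosed_conicHull {ι E : Type*} [Fintype ι] [AddCommGroup E] [Module ℝ E]
    [TopologicalSpace E] [IsTopologicalAddGroup E] [ContinuousSMul ℝ E] [T2Space E] (v : ι → E) :
    IsClosed {b : E | ∃ z : ι → ℝ, (∀ j, 0 ≤ z j) ∧ ∑ j, z j • v j = b} := by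
  classical
  have hU : {b : E | ∃ z : ι → ℝ, (∀ j, 0 ≤ z j) ∧ ∑ j, z j • v j = b} =
      ⋃ s ∈ {s : Finset ι | LinearIndepOn ℝ v (s : Set ι)},
        (Fintype.linearCombination ℝ fun j : s => v j) '' {z | ∀ j, 0 ≤ z j} := by
    ext b
    simp only [Set.mem_ofPred_eq, Set.mem_iUnion, Set.mem_image]
    constructor
    · rintro ⟨z, hz, rfl⟩
      obtain ⟨z', h1, -, h3, h4⟩ := conic_caratheodory v z hz
      refine ⟨Finset.univ.filter fun j => z' j ≠ 0, by simpa using h4, fun j => z' j,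
        fun j => h1 j, ?_⟩
      rw [← h3, Fintype.linearCombination_apply,
        Finset.sum_coe_sort (Finset.univ.filter fun j => z' j ≠ 0) (fun j => z' j • v j)]
      refine Finset.sum_subset (Finset.subset_univ _) fun j _ hj => ?_
      have : z' j = 0 := by simpa using hj
      simp [this]
    · rintro ⟨s, -, z, hz, rfl⟩
      refine ⟨fun j => if h : j ∈ s then z ⟨j, h⟩ else 0, fun j => ?_, ?_⟩
      · dsimp only
        split_ifs with h
        exacts [hz _, le_rfl]
      · rw [Fintype.linearCombination_apply, ← Finset.sum_subset (Finset.subset_univ s),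
          ← Finset.sum_coe_sort]
        · exact Finset.sum_congr rfl fun j _ => by simp
        · intro j _ hj
          simp [hj]
  rw [hU]
  refine Set.Finite.isClosed_biUnion (Set.toFinite _) fun s hs => ?_
  have hinj : Function.Injective (Fintype.linearCombination ℝ fun j : s => v j) := by
    rw [injective_iff_map_eq_zero]
    exact fun z hz => funext (Fintype.linearIndependent_iff.1 hs z hz)
  refine (LinearMap.isClosedEmbedding_of_injective (LinearMap.ker_eq_bot.2 hinj)).isClosedMap _ ?_
  simp only [Set.ofPred_forall]
  exact isClosed_iInter fun j => isClosed_le continuous_const (continuous_apply j)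

/-! ### Farkas' lemma and linear programming duality. -/

theorem exists_dotProduct_eq {k : ℕ} (f : (Fin k → ℝ) →ₗ[ℝ] ℝ) : ∃ δ, ∀ x, f x = x ⬝ᵥ δ := by
  refine ⟨fun i => f (Pi.single i 1), fun x => ?_⟩
  conv_lhs => rw [← Finset.univ_sum_single x]
  rw [map_sum]
  refine Finset.sum_congr rfl fun i _ => ?_
  have : (Pi.single i (x i) : Fin k → ℝ) = x i • Pi.single i 1 := by
    rw [← Pi.single_smul, smul_eq_mul, mul_one]
  rw [this, map_smul, smul_eq_mul]

/-- **Farkas' lemma**. -/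
theorem farkas {ι : Type*} [Fintype ι] {E : Type*} [AddCommGroup E] [Module ℝ E]
    [TopologicalSpace E] [IsTopologicalAddGroup E] [ContinuousSMul ℝ E] [T2Space E]
    [LocallyConvexSpace ℝ E] (v : ι → E) (b : E)
    (h : ∀ f : E →L[ℝ] ℝ, (∀ j, f (v j) ≤ 0) → f b ≤ 0) :
    ∃ z : ι → ℝ, (∀ j, 0 ≤ z j) ∧ ∑ j, z j • v j = b := by
  classical
  by_contra hb
  have hconv : Convex ℝ {b : E | ∃ z : ι → ℝ, (∀ j, 0 ≤ z j) ∧ ∑ j, z j • v j = b} := by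
    rintro _ ⟨z, hz, rfl⟩ _ ⟨w, hw, rfl⟩ α γ hα hγ -
    refine ⟨fun j => α * z j + γ * w j, fun j =>
      add_nonneg (mul_nonneg hα (hz j)) (mul_nonneg hγ (hw j)), ?_⟩
    simp [add_smul, mul_smul, Finset.sum_add_distrib, Finset.smul_sum]
  obtain ⟨f, u, hu, hbu⟩ := geometric_hahn_banach_closed_point hconv (isClosed_conicHull v) hb
  have h0 : 0 < u := by simpa using hu 0 ⟨0, by simp, by simp⟩
  refine absurd (h f fun j => ?_) (not_le.2 (h0.trans hbu))
  by_contra hj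
  push Not at hj
  -- On this multiple of `v j` the functional takes the value `u`, which it may not reach on the
  -- cone.
  have := hu ((u / f (v j)) • v j) ⟨Pi.single j (u / f (v j)), fun i => ?_, ?_⟩
  · rw [map_smul, smul_eq_mul, div_mul_cancel₀ _ hj.ne'] at this
    exact lt_irrefl _ this
  · by_cases hij : i = j
    · subst hij; simpa using (div_pos h0 hj).le
    · simp [hij]
  · rw [Finset.sum_eq_single j] <;> simp +contextual

/-- An optimal dual solution certifies a primal solution with the same value. -/
theorem exists_primal_of_dual_optimal {m n : ℕ} (A : Matrix (Fin m) (Fin n) ℝ) (b : Fin m → ℝ)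
    (c : Fin n → ℝ) (p : Fin m → ℝ) (hp : 0 ≤ p) (hpc : Aᵀ *ᵥ p ≤ c)
    (hopt : ∀ q, 0 ≤ q → Aᵀ *ᵥ q ≤ c → b ⬝ᵥ q ≤ b ⬝ᵥ p) :
    ∃ y : Fin n → ℝ, 0 ≤ y ∧ b ≤ A *ᵥ y ∧ c ⬝ᵥ y ≤ b ⬝ᵥ p := by
  classical
  -- The extra columns are the surplus of `b ≤ A y` and the slack of `c y ≤ b p`, so membership in
  -- the cone is the claim.
  obtain ⟨z, hz, hzb⟩ := farkas (E := (Fin m → ℝ) × ℝ)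
    (Sum.elim (fun j : Fin n => (Aᵀ j, c j))
      (Sum.elim (fun i : Fin m => (-Pi.single i 1, 0)) (fun _ : Unit => (0, 1))))
    (b, b ⬝ᵥ p) (by
      intro f hf
      obtain ⟨q, hq⟩ := exists_dotProduct_eq (f.toLinearMap ∘ₗ LinearMap.inl ℝ (Fin m → ℝ) ℝ)
      set θ := f (0, 1) with hθ
      have hfe : ∀ x t, f (x, t) = x ⬝ᵥ q + t * θ := by
        intro x t
        have h1 : (x, t) = (x, (0 : ℝ)) + t • ((0 : Fin m → ℝ), (1 : ℝ)) := by simp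
        rw [h1, map_add, map_smul, ← hq]
        simp [hθ]
      have hθ0 : θ ≤ 0 := by simpa [hfe] using hf (Sum.inr (Sum.inr ()))
      have hq0 : 0 ≤ q := fun i => by simpa [hfe] using hf (Sum.inr (Sum.inl i))
      have hqc : ∀ j, (Aᵀ *ᵥ q) j ≤ (-θ) * c j := fun j => by
        have := hf (Sum.inl j)
        simp only [Sum.elim_inl, hfe] at this
        change Aᵀ j ⬝ᵥ q ≤ _
        linarith
      rw [hfe]
      -- If `θ = 0`, then `q` is a recession direction and `p + q` is dual feasible; otherwise `q`
      -- scaled by `1 / (-θ)` is.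
      rcases hθ0.eq_or_lt with h | h
      · have := hopt (p + q) (add_nonneg hp hq0) (fun j => by
          have := hqc j
          rw [h] at this
          rw [mulVec_add, Pi.add_apply]
          have := hpc j
          linarith)
        rw [dotProduct_add] at this
        rw [h]
        linarith
      · have hi : 0 < (-θ)⁻¹ := inv_pos.2 (by linarith)
        have := hopt ((-θ)⁻¹ • q) (fun i => mul_nonneg hi.le (hq0 i)) (fun j => by
          rw [mulVec_smul, Pi.smul_apply, smul_eq_mul, inv_mul_le_iff₀ (by linarith)]
          exact hqc j)
        rw [dotProduct_smul, smul_eq_mul, inv_mul_le_iff₀ (by linarith)] at this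
        linarith)
  simp only [Fintype.sum_sum_type, Sum.elim_inl, Sum.elim_inr, Finset.univ_unique,
    Finset.sum_singleton, Prod.ext_iff, Prod.fst_add, Prod.snd_add, Prod.fst_sum, Prod.snd_sum,
    Prod.smul_fst, Prod.smul_snd] at hzb
  obtain ⟨h1, h2⟩ := hzb
  refine ⟨fun j => z (Sum.inl j), fun j => hz _, fun i => ?_, ?_⟩
  · have := congrFun h1 i
    simp [Finset.sum_apply, Pi.single_apply] at this
    rw [← this]
    simp only [mulVec, dotProduct]
    have h3 := hz (Sum.inr (Sum.inl i))
    have h4 : ∑ j, A i j * z (Sum.inl j) = ∑ j, z (Sum.inl j) * A i j :=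
      Finset.sum_congr rfl fun j _ => mul_comm _ _
    linarith
  · rw [← h2]
    have h3 := hz (Sum.inr (Sum.inr default))
    simp [dotProduct, mul_comm] at h3 ⊢
    linarith

/-! ### Bases and vertices of polyhedra. -/

theorem eq_zero_of_basis {k : ℕ} {ι : Type*} {v : ι → Fin k → ℝ} {B : Finset ι}
    (hB : B.card = k) (hli : LinearIndependent ℝ fun j : B => v j) {δ : Fin k → ℝ}
    (hδ : ∀ j ∈ B, v j ⬝ᵥ δ = 0) : δ = 0 := by
  have hspan := hli.span_eq_top_of_card_eq_finrank' (by simp [hB])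
  have : ∀ x ∈ Submodule.span ℝ (Set.range fun j : B => v j), x ⬝ᵥ δ = 0 := by
    intro x hx
    induction hx using Submodule.span_induction with
    | mem x h => obtain ⟨j, rfl⟩ := h; exact hδ j j.2
    | zero => simp
    | add x y _ _ hx hy => rw [add_dotProduct, hx, hy, add_zero]
    | smul a x _ hx => rw [smul_dotProduct, hx, smul_zero]
  exact dotProduct_self_eq_zero.1 (this δ (by rw [hspan]; trivial))

/-- `hZ` says dually that `Z` spans, so a maximal independent extension of `I` inside `Z` is a
basis. -/
theorem exists_basis_between {k : ℕ} {ι : Type*} [Finite ι] {v : ι → Fin k → ℝ} {I Z : Set ι}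
    (hIZ : I ⊆ Z) (hI : LinearIndepOn ℝ v I)
    (hZ : ∀ δ : Fin k → ℝ, (∀ j ∈ Z, v j ⬝ᵥ δ = 0) → δ = 0) :
    ∃ B : Finset ι, I ⊆ B ∧ (B : Set ι) ⊆ Z ∧ B.card = k ∧
      LinearIndependent ℝ fun j : B => v j := by
  classical
  obtain ⟨B, hBZ, hIB, hZB, hB⟩ := exists_linearIndepOn_extension hI hIZ
  have hBf : B.Finite := Set.toFinite B
  lift B to Finset ι using hBf
  have hspan : Submodule.span ℝ (v '' B) = ⊤ := by
    by_contra h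
    obtain ⟨f, hf0, hf⟩ := Submodule.exists_le_ker_of_lt_top _ (lt_top_iff_ne_top.2 h)
    obtain ⟨δ, hδ⟩ := exists_dotProduct_eq f
    refine hf0 (LinearMap.ext fun x => ?_)
    rw [hδ, hZ δ fun j hj => ?_]
    · simp
    · rw [← hδ]
      exact hf (hZB ⟨j, hj, rfl⟩)
  refine ⟨B, hIB, hBZ, ?_, hB⟩
  have hB' : LinearIndependent ℝ fun j : B => v j := hB
  have h1 := finrank_span_eq_card hB'
  have h2 : Set.range (fun j : B => v j) = v '' B := by ext; simp
  rw [h2, hspan, finrank_top] at h1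
  simpa using h1.symm

/-- While the tight normals do not span, one can move orthogonally to them until another constraint
becomes tight; `hv` excludes lines in the polyhedron. -/
theorem exists_vertex_above {k : ℕ} {ι : Type*} [Fintype ι] (v : ι → Fin k → ℝ) (c : ι → ℝ)
    (hv : ∀ δ : Fin k → ℝ, (∀ j, v j ⬝ᵥ δ = 0) → δ = 0)
    (p : Fin k → ℝ) (hp : ∀ j, c j ≤ v j ⬝ᵥ p) :
    ∃ q : Fin k → ℝ, (∀ j, c j ≤ v j ⬝ᵥ q) ∧ (∀ j, v j ⬝ᵥ p = c j → v j ⬝ᵥ q = c j) ∧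
      ∀ δ : Fin k → ℝ, (∀ j, v j ⬝ᵥ q = c j → v j ⬝ᵥ δ = 0) → δ = 0 := by
  classical
  induction hn : (Finset.univ.filter fun j => v j ⬝ᵥ p ≠ c j).card using Nat.strong_induction_on
    generalizing p with
  | _ n ih =>
    by_cases hsp : ∀ δ : Fin k → ℝ, (∀ j, v j ⬝ᵥ p = c j → v j ⬝ᵥ δ = 0) → δ = 0
    · exact ⟨p, hp, fun _ h => h, hsp⟩
    push Not at hsp
    obtain ⟨δ, hδ, hδ0, i, hi⟩ : ∃ δ : Fin k → ℝ, (∀ j, v j ⬝ᵥ p = c j → v j ⬝ᵥ δ = 0) ∧ δ ≠ 0 ∧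
        ∃ j, v j ⬝ᵥ δ < 0 := by
      obtain ⟨δ, hδ, hδ0⟩ := hsp
      have : ∃ j, v j ⬝ᵥ δ ≠ 0 := by
        by_contra h
        push Not at h
        exact hδ0 (hv δ h)
      obtain ⟨j, hj⟩ := this
      rcases lt_or_gt_of_ne hj with h | h
      · exact ⟨δ, hδ, hδ0, j, h⟩
      · exact ⟨-δ, fun i hi => by simp [hδ i hi], by simpa using hδ0, j, by simpa using h⟩
    obtain ⟨t, ht, m, hm, hm0⟩ := exists_ratio (fun j => v j ⬝ᵥ p - c j) (fun j => v j ⬝ᵥ δ)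
      (fun j => sub_nonneg.2 (hp j)) ⟨i, hi⟩
    have he : ∀ j, v j ⬝ᵥ (p + t • δ) = v j ⬝ᵥ p + t * (v j ⬝ᵥ δ) := fun j => by
      rw [dotProduct_add, dotProduct_smul, smul_eq_mul]
    have hkeep : ∀ j, v j ⬝ᵥ p = c j → v j ⬝ᵥ (p + t • δ) = c j := fun j hj => by
      rw [he, hδ j hj, hj, mul_zero, add_zero]
    obtain ⟨q, h1, h2, h3⟩ := ih _ (by
      rw [← hn]
      apply Finset.card_lt_card
      refine ⟨fun j hj => ?_, fun h => ?_⟩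
      · simp only [Finset.mem_filter, Finset.mem_univ, true_and] at hj ⊢
        exact fun h => hj (hkeep j h)
      · have hmp : m ∈ Finset.univ.filter fun j => v j ⬝ᵥ p ≠ c j := by
          simp only [Finset.mem_filter, Finset.mem_univ, true_and]
          exact fun h => hm.ne (hδ m h)
        have := h hmp
        simp only [Finset.mem_filter, Finset.mem_univ, true_and] at this
        exact this (by rw [he]; linarith)) (p + t • δ)
        (fun j => by rw [he]; linarith [ht j]) rfl
    exact ⟨q, h1, fun j hj => h2 j (hkeep j hj), h3⟩

theorem exists_perturbation {k : ℕ} {ι : Type*} [Finite ι] (v : ι → Fin k → ℝ) (a : ι → ℝ)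
    {p δ : Fin k → ℝ} (hp : ∀ j, a j ≤ v j ⬝ᵥ p) (hδ : ∀ j, v j ⬝ᵥ p = a j → v j ⬝ᵥ δ = 0) :
    ∃ ε : ℝ, 0 < ε ∧ (∀ j, a j ≤ v j ⬝ᵥ (p + ε • δ)) ∧ ∀ j, a j ≤ v j ⬝ᵥ (p - ε • δ) := by
  have key : ∀ δ : Fin k → ℝ, (∀ j, v j ⬝ᵥ p = a j → v j ⬝ᵥ δ = 0) →
      ∀ᶠ ε in nhds (0 : ℝ), ∀ j, a j ≤ v j ⬝ᵥ (p + ε • δ) := by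
    intro δ hδ
    rw [Filter.eventually_all]
    intro j
    simp only [dotProduct_add, dotProduct_smul, smul_eq_mul]
    rcases (hp j).eq_or_lt with h | h
    · refine Filter.Eventually.of_forall fun ε => ?_
      rw [hδ j h.symm, mul_zero, add_zero, h]
    · have hc : Continuous fun ε : ℝ => v j ⬝ᵥ p + ε * (v j ⬝ᵥ δ) := by fun_prop
      have ht := hc.tendsto 0
      simp only [zero_mul, add_zero] at ht
      exact (ht.eventually_const_lt h).mono fun _ => le_of_lt
  have h1 := key δ hδ
  have h2 := key (-δ) fun j hj => by rw [dotProduct_neg, hδ j hj, neg_zero]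
  obtain ⟨ε, ⟨ha, hb⟩, hε⟩ := (((h1.and h2).filter_mono nhdsWithin_le_nhds).and
    (eventually_mem_nhdsWithin (a := (0 : ℝ)) (s := Set.Ioi 0))).exists
  refine ⟨ε, hε, ha, fun j => ?_⟩
  have := hb j
  rwa [smul_neg, ← sub_eq_add_neg] at this

namespace TwoStageRO

variable {nx mx kx nu mu ku ny ky : ℕ} (P : TwoStageRO nx mx kx nu mu ku ny ky)

/-! ### Extreme points and extreme rays of the dual polyhedron -/

/-- The constraint normals of `dualSet` (in `≥` form), together with the all-ones vector. -/
def dualRow : Option (Fin ny ⊕ Fin ky) → Fin ky → ℝ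
  | none => 1
  | some (Sum.inl j) => -(P.B2ᵀ j)
  | some (Sum.inr i) => Pi.single i 1

/-- The right-hand side of the constraints `B2ᵀ p ≤ c`, `0 ≤ p` in `≥` form. -/
def dualRhs (c : Fin ny → ℝ) : Fin ny ⊕ Fin ky → ℝ := Sum.elim (-c) 0

theorem dual_feasible_iff (c : Fin ny → ℝ) (p : Fin ky → ℝ) :
    (0 ≤ p ∧ P.B2ᵀ *ᵥ p ≤ c) ↔ ∀ j, dualRhs c j ≤ P.dualRow (some j) ⬝ᵥ p := by
  have hl : ∀ j, P.dualRow (some (Sum.inl j)) ⬝ᵥ p = -(P.B2ᵀ *ᵥ p) j := fun j =>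
    neg_dotProduct _ _
  have hr : ∀ i, P.dualRow (some (Sum.inr i)) ⬝ᵥ p = p i := fun i =>
    single_one_dotProduct _ _
  rw [Sum.forall]
  simp only [hl, hr, dualRhs, Sum.elim_inl, Sum.elim_inr, Pi.neg_apply, neg_le_neg_iff]
  exact and_comm

/-- A `δ` orthogonal to all tight normals would make `p` the midpoint of `p ± ε δ`, so extremality
makes the tight normals span. -/
theorem exists_basis_of_mem_extrPoints {p : Fin ky → ℝ} (hp : p ∈ P.extrPoints) :
    ∃ B : Finset (Option (Fin ny ⊕ Fin ky)), B.card = ky ∧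
      (LinearIndependent ℝ fun j : B => P.dualRow j) ∧ none ∉ B ∧
      ∀ j, some j ∈ B → P.dualRow (some j) ⬝ᵥ p = dualRhs P.c2 j := by
  obtain ⟨hpS, hext⟩ := hp
  obtain ⟨B, -, hBZ, hc, hli⟩ := exists_basis_between (v := P.dualRow) (I := ∅)
    (Z := {j | ∃ i, j = some i ∧ P.dualRow (some i) ⬝ᵥ p = dualRhs P.c2 i})
    (Set.empty_subset _) (linearIndepOn_empty ℝ _) (by
      intro δ hδ
      obtain ⟨ε, hε, h1, h2⟩ := exists_perturbation (fun j => P.dualRow (some j)) (dualRhs P.c2)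
        ((P.dual_feasible_iff _ _).1 hpS) (fun j hj => hδ _ ⟨j, rfl, hj⟩)
      have h := hext ((P.dual_feasible_iff _ _).2 h1) ((P.dual_feasible_iff _ _).2 h2)
        ⟨1 / 2, 1 / 2, by norm_num, by norm_num, by norm_num, by module⟩
      have : ε • δ = 0 := by simpa using h
      exact (smul_eq_zero.1 this).resolve_left hε.ne')
  refine ⟨B, hc, hli, fun h => ?_, fun j hj => ?_⟩
  · obtain ⟨i, hi, -⟩ := hBZ h
    cases hi
  · obtain ⟨i, hi, h⟩ := hBZ hj
    cases hi
    exact h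

theorem exists_basis_of_mem_extrRays {g : Fin ky → ℝ} (hg : g ∈ P.extrRays) :
    ∃ B : Finset (Option (Fin ny ⊕ Fin ky)), B.card = ky ∧
      (LinearIndependent ℝ fun j : B => P.dualRow j) ∧ none ∈ B ∧
      ∀ j, some j ∈ B → P.dualRow (some j) ⬝ᵥ g = 0 := by
  obtain ⟨hgC, hsum, hext⟩ := hg
  have hrhs : ∀ j, dualRhs (ky := ky) (0 : Fin ny → ℝ) j = 0 := by rintro (j | j) <;> simp [dualRhs]
  -- The all-ones row must be nonzero to be forced into the basis; this excludes `ky = 0`.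
  have hone : P.dualRow none ≠ 0 := by
    intro h
    have : (1 : Fin ky → ℝ) = 0 := h
    rw [← one_dotProduct, this, zero_dotProduct] at hsum
    exact zero_ne_one hsum
  obtain ⟨B, hIB, hBZ, hc, hli⟩ := exists_basis_between (v := P.dualRow) (I := {none})
    (Z := {j | ∀ i, j = some i → P.dualRow (some i) ⬝ᵥ g = 0})
    (by simp) (LinearIndepOn.singleton hone) (by
      intro δ hδ
      obtain ⟨ε, hε, h1, h2⟩ := exists_perturbation (fun j => P.dualRow (some j)) (dualRhs 0)
        ((P.dual_feasible_iff _ _).1 hgC) (fun j hj => hδ _ (by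
          rintro i hi
          cases hi
          rw [hj, hrhs]))
      have hmem : ∀ q, (∀ j, dualRhs 0 j ≤ P.dualRow (some j) ⬝ᵥ q) →
          (1 / 2 : ℝ) • q ∈ P.dualCone := fun q hq =>
        (P.dual_feasible_iff _ _).2 fun j => by
          have := hq j
          rw [hrhs] at this ⊢
          rw [dotProduct_smul, smul_eq_mul]
          positivity
      obtain ⟨s, hs⟩ := hext _ (hmem _ h1) _ (hmem _ h2) (by module)
      have h1δ : (1 : Fin ky → ℝ) ⬝ᵥ δ = 0 := hδ none (by simp)
      have h1g : (1 : Fin ky → ℝ) ⬝ᵥ g = 1 := by rw [one_dotProduct, hsum]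
      -- Comparing coordinate sums, as `δ` is orthogonal to the all-ones row.
      have hs' : s = 1 / 2 := by
        have := congrArg (fun q => (1 : Fin ky → ℝ) ⬝ᵥ q) hs
        simp only [dotProduct_smul, dotProduct_add, h1δ, h1g, smul_eq_mul] at this
        linarith
      rw [hs', smul_add, add_eq_left] at hs
      exact (smul_eq_zero.1 ((smul_eq_zero.1 hs).resolve_left (by norm_num))).resolve_left hε.ne')
  exact ⟨B, hc, hli, hIB rfl, fun j hj => hBZ hj j rfl⟩

/-- A basis of `ky` among the `ny + ky + 1` rows encodes each element: containing `none` or not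
tells ray from point, which fixes the right-hand sides and hence the solution. -/
theorem encard_extrPoints_union_extrRays_le :
    (P.extrPoints ∪ P.extrRays).encard ≤ ((ny + ky + 1).choose ky : ℕ) := by
  classical
  have hex : ∀ p ∈ P.extrPoints ∪ P.extrRays, ∃ B : Finset (Option (Fin ny ⊕ Fin ky)),
      B.card = ky ∧ (LinearIndependent ℝ fun j : B => P.dualRow j) ∧
      ∀ j ∈ B, P.dualRow j ⬝ᵥ p =
        if none ∈ B then j.elim 1 0 else j.elim 0 (dualRhs P.c2) := by
    rintro p (hp | hp)
    · obtain ⟨B, hc, hli, hn, hB⟩ := P.exists_basis_of_mem_extrPoints hp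
      refine ⟨B, hc, hli, ?_⟩
      rintro (_ | j) hj
      · exact absurd hj hn
      · simpa [hn] using hB j hj
    · obtain ⟨B, hc, hli, hn, hB⟩ := P.exists_basis_of_mem_extrRays hp
      refine ⟨B, hc, hli, ?_⟩
      rintro (_ | j) hj
      · rw [if_pos hn]
        exact (one_dotProduct p).trans hp.2.1
      · simpa [hn] using hB j hj
  choose! f hf using hex
  have hinj : Set.InjOn f (P.extrPoints ∪ P.extrRays) := by
    intro p hp q hq hpq
    obtain ⟨hc, hli, h1⟩ := hf p hp
    obtain ⟨-, -, h2⟩ := hf q hq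
    rw [← hpq] at h2
    exact sub_eq_zero.1 (eq_zero_of_basis hc hli fun j hj => by
      rw [dotProduct_sub, h1 j hj, h2 j hj, sub_self])
  have hmaps : Set.MapsTo f (P.extrPoints ∪ P.extrRays)
      (Finset.powersetCard ky (Finset.univ : Finset (Option (Fin ny ⊕ Fin ky)))) := by
    intro p hp
    simp [Finset.mem_powersetCard, (hf p hp).1]
  refine (Set.encard_le_encard_of_injOn hmaps hinj).trans ?_
  rw [Set.encard_coe_eq_coe_finsetCard, Finset.card_powersetCard]
  simp

/-! ### The penalized linear program -/

/-- The cost vector of `LP(x, ud, beta)` on the columns of the tableau. -/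
def cost (beta : Fin ky → ℝ) : Fin nu ⊕ Fin ku → ℝ := Sum.elim (-(P.Ecᵀ *ᵥ beta)) 0

/-- `lam` is the vector of simplex multipliers of the basis `B`, and the reduced costs of all columns
of `LP(x, ud, beta)` have the optimal sign. -/
def IsDualMultiplier (M : ℝ) (beta : Fin ky → ℝ) (B : Finset (Fin nu ⊕ Fin ku))
    (lam : Fin ku → ℝ) : Prop :=
  (∀ j, Sum.inl j ∈ B → (P.Fcᵀ *ᵥ lam) j = (-(P.Ecᵀ *ᵥ beta)) j) ∧
    (∀ i, Sum.inr i ∈ B → lam i = 0) ∧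
    -(P.Ecᵀ *ᵥ beta) ≤ P.Fcᵀ *ᵥ lam ∧ 0 ≤ lam ∧ (∀ i, lam i ≤ M)

theorem tableau_inl_dotProduct (j : Fin nu) (lam : Fin ku → ℝ) :
    (fun i => P.tableau i (Sum.inl j)) ⬝ᵥ lam = (P.Fcᵀ *ᵥ lam) j := rfl

theorem tableau_inr_dotProduct (i : Fin ku) (lam : Fin ku → ℝ) :
    (fun i' => P.tableau i' (Sum.inr i)) ⬝ᵥ lam = lam i := by
  simp [tableau, dotProduct, one_apply]

theorem sum_smul_tableau (z : Fin nu ⊕ Fin ku → ℝ) :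
    ∑ j, z j • (fun i => P.tableau i j) =
      P.Fc *ᵥ (fun j => z (Sum.inl j)) + fun i => z (Sum.inr i) := by
  ext i
  simp [Fintype.sum_sum_type, tableau, mulVec, dotProduct, one_apply, mul_comm]

/-- The duality gap of a point of `LP(x, ud, beta)` with respect to multipliers `lam`. -/
theorem lpObj_eq (M : ℝ) (x : Fin nx ⊕ Fin mx → ℝ) (ud : Fin mu → ℕ) (beta : Fin ky → ℝ)
    (q : (Fin nu → ℝ) × (Fin ku → ℝ)) (lam : Fin ku → ℝ) :
    P.lpObj M beta q = lam ⬝ᵥ P.rhs x ud - lam ⬝ᵥ (P.rhs x ud - P.Fc *ᵥ q.1 + q.2) -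
      q.1 ⬝ᵥ (P.Fcᵀ *ᵥ lam + P.Ecᵀ *ᵥ beta) - ∑ i, q.2 i * (M - lam i) := by
  have h1 : (P.Ec *ᵥ q.1) ⬝ᵥ beta = q.1 ⬝ᵥ (P.Ecᵀ *ᵥ beta) := by
    rw [mulVec_transpose, dotProduct_comm, dotProduct_mulVec, dotProduct_comm]
  have h2 : lam ⬝ᵥ (P.Fc *ᵥ q.1) = q.1 ⬝ᵥ (P.Fcᵀ *ᵥ lam) := by
    rw [mulVec_transpose, dotProduct_mulVec, dotProduct_comm]
  have h3 : ∑ i, q.2 i * (M - lam i) = M * ∑ i, q.2 i - lam ⬝ᵥ q.2 := by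
    rw [Finset.mul_sum, dotProduct, ← Finset.sum_sub_distrib]
    exact Finset.sum_congr rfl fun i _ => by ring
  rw [lpObj, h3, dotProduct_add, dotProduct_add, dotProduct_sub, h2, neg_dotProduct, h1]
  ring

variable {P}

/-- The three gap terms of `lpObj_eq` vanish at a KKT point and are nonnegative at every feasible
point. -/
theorem OU.mem_lpOptimal {M : ℝ} {x : Fin nx ⊕ Fin mx → ℝ} {ud : Fin mu → ℕ} {beta : Fin ky → ℝ}
    {q : (Fin nu → ℝ) × (Fin ku → ℝ) × (Fin ku → ℝ)} (hq : q ∈ P.OU M x ud beta) :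
    (q.1, q.2.1) ∈ P.lpOptimal M x ud beta := by
  obtain ⟨h1, h2, h3, h4, h5, h6, h7, h8, h9⟩ := hq
  refine ⟨⟨h7, h8, h1⟩, fun r ⟨hr1, hr2, hr3⟩ => ?_⟩
  rw [P.lpObj_eq M x ud beta r q.2.2, P.lpObj_eq M x ud beta _ q.2.2]
  have e1 : q.2.2 ⬝ᵥ (P.rhs x ud - P.Fc *ᵥ q.1 + q.2.1) = 0 := Finset.sum_eq_zero fun i _ => h4 i
  have e2 : q.1 ⬝ᵥ (P.Fcᵀ *ᵥ q.2.2 + P.Ecᵀ *ᵥ beta) = 0 := Finset.sum_eq_zero fun i _ => h5 i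
  have e3 : ∑ i, q.2.1 i * (M - q.2.2 i) = 0 := Finset.sum_eq_zero fun i _ => h6 i
  have f1 : 0 ≤ q.2.2 ⬝ᵥ (P.rhs x ud - P.Fc *ᵥ r.1 + r.2) :=
    dotProduct_nonneg_of_nonneg h9 fun i => by
      have := hr3 i
      simp only [Pi.add_apply, Pi.sub_apply, Pi.zero_apply] at this ⊢
      linarith
  have f2 : 0 ≤ r.1 ⬝ᵥ (P.Fcᵀ *ᵥ q.2.2 + P.Ecᵀ *ᵥ beta) :=
    dotProduct_nonneg_of_nonneg hr1 fun i => by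
      have := h2 i
      simp only [Pi.add_apply, Pi.neg_apply, Pi.zero_apply] at this ⊢
      linarith
  have f3 : 0 ≤ ∑ i, r.2 i * (M - q.2.2 i) :=
    Finset.sum_nonneg fun i _ => mul_nonneg (hr2 i) (sub_nonneg.2 (h3 i))
  simp only [e1, e2, e3]
  linarith

theorem IsBasisFor.mem_USlice {x : Fin nx ⊕ Fin mx → ℝ} {ud : Fin mu → ℕ}
    {B : Finset (Fin nu ⊕ Fin ku)} {uc : Fin nu → ℝ} (hB : P.IsBasisFor x ud B uc) :
    uc ∈ P.USlice x ud := by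
  obtain ⟨-, s, h0, hs, h, -⟩ := hB
  exact ⟨h0, h ▸ le_add_of_nonneg_right hs⟩

/-- Complementary slackness: reduced costs vanish on `B`, variables vanish off `B`. Since `hlam`
does not mention `x`, multipliers from one iteration serve in another. -/
theorem IsBasisFor.mem_OU {M : ℝ} {x : Fin nx ⊕ Fin mx → ℝ} {ud : Fin mu → ℕ}
    {beta : Fin ky → ℝ} {B : Finset (Fin nu ⊕ Fin ku)} {uc : Fin nu → ℝ} {lam : Fin ku → ℝ}
    (hB : P.IsBasisFor x ud B uc) (hlam : P.IsDualMultiplier M beta B lam) :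
    (uc, 0, lam) ∈ P.OU M x ud beta := by
  have hU := hB.mem_USlice
  obtain ⟨-, s, h0, hs, h, hu, hsB⟩ := hB
  obtain ⟨l1, l2, l3, l4, l5⟩ := hlam
  refine ⟨by simpa using hU.2, l3, l5, fun i => ?_, fun j => ?_, by simp, h0, le_rfl, l4⟩
  · have : (P.rhs x ud - P.Fc *ᵥ uc + 0) i = s i := by simp [← h]
    change lam i * (P.rhs x ud - P.Fc *ᵥ uc + 0) i = 0
    rw [this]
    by_cases hi : Sum.inr i ∈ B
    · rw [l2 i hi, zero_mul]
    · rw [hsB i hi, mul_zero]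
  · by_cases hj : Sum.inl j ∈ B
    · simp [l1 j hj]
    · simp [hu j hj]

theorem IsBasisFor.demand_le {M : ℝ} {x : Fin nx ⊕ Fin mx → ℝ} {ud : Fin mu → ℕ}
    {beta : Fin ky → ℝ} {B : Finset (Fin nu ⊕ Fin ku)} {uc uc' : Fin nu → ℝ} {lam : Fin ku → ℝ}
    (hB : P.IsBasisFor x ud B uc) (hlam : P.IsDualMultiplier M beta B lam)
    (hu : uc' ∈ P.USlice x ud) :
    P.demand x uc' ud ⬝ᵥ beta ≤ P.demand x uc ud ⬝ᵥ beta := by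
  have := (OU.mem_lpOptimal (hB.mem_OU hlam)).2 (uc', 0)
    ⟨hu.1, le_rfl, by simpa using hu.2⟩
  simp only [lpObj, Pi.zero_apply, Finset.sum_const_zero, mul_zero, sub_zero,
    neg_dotProduct, neg_le_neg_iff] at this
  simp only [demand, sub_dotProduct]
  linarith

theorem Uniqueness.eq_of_mem_OU {M : ℝ} (hU : P.Uniqueness M) {x : Fin nx ⊕ Fin mx → ℝ}
    (hx : x ∈ P.X) {ud : Fin mu → ℕ} (hud : ud ∈ P.Ud) {beta : Fin ky → ℝ}
    (hb : beta ∈ P.extrPoints ∪ P.extrRays) {B : Finset (Fin nu ⊕ Fin ku)} {uc : Fin nu → ℝ}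
    {lam : Fin ku → ℝ} (hB : P.IsBasisFor x ud B uc) (hlam : P.IsDualMultiplier M beta B lam)
    {q : (Fin nu → ℝ) × (Fin ku → ℝ) × (Fin ku → ℝ)} (hq : q ∈ P.OU M x ud beta) :
    q.1 = uc ∧ q.2.1 = 0 := by
  have := (hU x hx ud hud beta hb).unique (OU.mem_lpOptimal hq)
    (OU.mem_lpOptimal (hB.mem_OU hlam))
  exact Prod.ext_iff.1 this

variable (P)

/-- The multipliers of all bases, over all extreme points and rays, are bounded. -/
theorem exists_multiplier_bound : ∃ M₀ : ℝ, ∀ beta ∈ P.extrPoints ∪ P.extrRays,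
    ∀ B : Finset (Fin nu ⊕ Fin ku), P.IsBasis B → ∀ lam : Fin ku → ℝ,
      (∀ j ∈ B, (fun i => P.tableau i j) ⬝ᵥ lam = P.cost beta j) → ∀ i, lam i ≤ M₀ := by
  have hfin : (P.extrPoints ∪ P.extrRays).Finite := Set.finite_of_encard_le_coe
    P.encard_extrPoints_union_extrRays_le
  have hS : {lam : Fin ku → ℝ | ∃ beta ∈ P.extrPoints ∪ P.extrRays, ∃ B, P.IsBasis B ∧
      ∀ j ∈ B, (fun i => P.tableau i j) ⬝ᵥ lam = P.cost beta j}.Finite := by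
    have : ∀ beta ∈ P.extrPoints ∪ P.extrRays, {lam : Fin ku → ℝ | ∃ B, P.IsBasis B ∧
        ∀ j ∈ B, (fun i => P.tableau i j) ⬝ᵥ lam = P.cost beta j}.Finite := by
      intro beta _
      simp only [Set.ofPred_exists]
      -- A basis determines its multipliers.
      refine Set.finite_iUnion fun B => Set.Subsingleton.finite ?_
      rintro l ⟨hB, hl⟩ l' ⟨-, hl'⟩
      exact sub_eq_zero.1 (eq_zero_of_basis (v := fun j i => P.tableau i j) hB.1 hB.2 fun j hj => by
        rw [dotProduct_sub, hl j hj, hl' j hj, sub_self])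
    refine (hfin.biUnion this).subset ?_
    rintro lam ⟨beta, hb, h⟩
    exact Set.mem_biUnion hb h
  obtain ⟨f, hf⟩ := hS.bddAbove
  obtain ⟨M₀, hM⟩ := (Set.finite_range f).bddAbove
  exact ⟨M₀, fun beta hb B hB lam hl i => (hf ⟨beta, hb, B, hB, hl⟩ i).trans (hM ⟨i, rfl⟩)⟩

/-- Compactness gives a maximizer without artificial variables and duality gives multipliers; a
basis then fits between the primal support and the tight dual constraints. -/
theorem exists_basis_of_nonempty (hA2 : P.AssumptionA2) {x : Fin nx ⊕ Fin mx → ℝ} (hx : x ∈ P.X)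
    {ud : Fin mu → ℕ} (hud : ud ∈ P.Ud) (hne : (P.USlice x ud).Nonempty) {M : ℝ}
    (beta : Fin ky → ℝ)
    (hM : ∀ B : Finset (Fin nu ⊕ Fin ku), P.IsBasis B → ∀ lam : Fin ku → ℝ,
      (∀ j ∈ B, (fun i => P.tableau i j) ⬝ᵥ lam = P.cost beta j) → ∀ i, lam i ≤ M) :
    ∃ B uc lam, P.IsBasisFor x ud B uc ∧ P.IsDualMultiplier M beta B lam := by
  obtain ⟨C, hC⟩ := hA2 x hx
  have hcpt : IsCompact (P.USlice x ud) := by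
    refine (isCompact_Icc (a := (0 : Fin nu → ℝ)) (b := fun _ => C)).of_isClosed_subset ?_
      fun u hu => ⟨hu.1, fun j => hC (u, ud) ⟨hud, hu⟩ j⟩
    exact (isClosed_le continuous_const continuous_id).inter
      (isClosed_le (f := fun u => P.Fc *ᵥ u) (by fun_prop) continuous_const)
  obtain ⟨u₀, hu₀, hmax⟩ := hcpt.exists_isMaxOn hne
    (f := fun u => (-(P.Ecᵀ *ᵥ beta)) ⬝ᵥ u) (by fun_prop)
  -- Duality with the roles exchanged: the maximizer `u₀` is the dual solution for the matrix `Fcᵀ`.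
  obtain ⟨l₀, hl0, hl1, hl2⟩ := exists_primal_of_dual_optimal P.Fcᵀ (-(P.Ecᵀ *ᵥ beta))
    (P.rhs x ud) u₀ hu₀.1 (by simpa using hu₀.2) (fun q h0 hq => hmax ⟨h0, by simpa using hq⟩)
  set z : Fin nu ⊕ Fin ku → ℝ := Sum.elim u₀ (P.rhs x ud - P.Fc *ᵥ u₀) with hz
  have hz0 : ∀ j, 0 ≤ z j := by
    rintro (j | i)
    · exact hu₀.1 j
    · exact sub_nonneg.2 (hu₀.2 i)
  have hgap : ∀ j, P.cost beta j ≤ (fun i => P.tableau i j) ⬝ᵥ l₀ := by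
    rintro (j | i)
    · exact hl1 j
    · rw [tableau_inr_dotProduct]; exact hl0 i
  have hcs : ∀ j, z j * ((fun i => P.tableau i j) ⬝ᵥ l₀ - P.cost beta j) = 0 := by
    have hnn : ∀ j ∈ Finset.univ, 0 ≤ z j * ((fun i => P.tableau i j) ⬝ᵥ l₀ - P.cost beta j) :=
      fun j _ => mul_nonneg (hz0 j) (sub_nonneg.2 (hgap j))
    have hle : ∑ j, z j * ((fun i => P.tableau i j) ⬝ᵥ l₀ - P.cost beta j) ≤ 0 := by
      have e1 : ∑ j, u₀ j * ((P.Fcᵀ *ᵥ l₀) j - (-(P.Ecᵀ *ᵥ beta)) j) =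
          u₀ ⬝ᵥ (P.Fcᵀ *ᵥ l₀) - (-(P.Ecᵀ *ᵥ beta)) ⬝ᵥ u₀ := by
        rw [dotProduct_comm (-(P.Ecᵀ *ᵥ beta)), ← dotProduct_sub]; rfl
      have e2 : ∑ i, (P.rhs x ud - P.Fc *ᵥ u₀) i * (l₀ i - 0) =
          P.rhs x ud ⬝ᵥ l₀ - (P.Fc *ᵥ u₀) ⬝ᵥ l₀ := by
        rw [← sub_dotProduct]; simp [dotProduct]
      have e3 : (P.Fc *ᵥ u₀) ⬝ᵥ l₀ = u₀ ⬝ᵥ (P.Fcᵀ *ᵥ l₀) := by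
        rw [mulVec_transpose, dotProduct_comm, dotProduct_mulVec, dotProduct_comm]
      rw [Fintype.sum_sum_type]
      simp only [tableau_inr_dotProduct, tableau_inl_dotProduct, hz, cost, Sum.elim_inl,
        Sum.elim_inr, Pi.zero_apply]
      rw [e1, e2, e3]
      linarith
    intro j
    exact (Finset.sum_eq_zero_iff_of_nonneg hnn).1 (le_antisymm hle (Finset.sum_nonneg hnn)) j
      (Finset.mem_univ j)
  obtain ⟨lam, hlam, htight, hspan⟩ := exists_vertex_above
    (fun (j : Fin nu ⊕ Fin ku) (i : Fin ku) => P.tableau i j) (P.cost beta)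
    (fun δ hδ => funext fun i => by rw [← P.tableau_inr_dotProduct i δ]; exact hδ _) l₀ hgap
  obtain ⟨z', h0, hsupp, hsum, hli⟩ := conic_caratheodory
    (fun (j : Fin nu ⊕ Fin ku) (i : Fin ku) => P.tableau i j) z hz0
  -- The support only shrank and tight constraints stayed tight, so complementary slackness survives
  -- both moves.
  obtain ⟨B, hIB, hBZ, hcard, hBli⟩ := exists_basis_between
    (Z := {j | (fun i => P.tableau i j) ⬝ᵥ lam = P.cost beta j}) (fun j hj => htight j (by
      have hzj : z j ≠ 0 := fun h => hj (hsupp j h)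
      have := (mul_eq_zero.1 (hcs j)).resolve_left hzj
      linarith)) hli (fun δ hδ => hspan δ hδ)
  have hB : P.IsBasis B := ⟨hcard, hBli⟩
  have hout : ∀ j, j ∉ B → z' j = 0 := fun j hj => by
    by_contra h
    exact hj (hIB h)
  refine ⟨B, fun j => z' (Sum.inl j), lam, ⟨hB, fun i => z' (Sum.inr i), fun j => h0 _,
    fun i => h0 _, ?_, fun j => hout _, fun i => hout _⟩, ?_, ?_, ?_, ?_, ?_⟩
  · rw [← sum_smul_tableau, hsum, sum_smul_tableau]
    simp only [hz, Sum.elim_inl, Sum.elim_inr]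
    ext i
    simp
  · exact fun j hj => hBZ hj
  · exact fun i hi => by rw [← P.tableau_inr_dotProduct i lam]; exact hBZ hi
  · exact fun j => hlam (Sum.inl j)
  · exact fun i => by have := hlam (Sum.inr i); rwa [tableau_inr_dotProduct] at this
  · exact hM B hB lam fun j hj => hBZ hj

end TwoStageRO

theorem natCast_le_encard_of_injOn {α : Type*} {s : Set α} {N : ℕ} (f : ℕ → α)
    (hf : ∀ t < N, f t ∈ s) (hinj : ∀ t₁ t₂, t₁ < t₂ → t₂ < N → f t₁ ≠ f t₂) :
    (N : ℕ∞) ≤ s.encard := by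
  have hi : Set.InjOn f (Finset.range N) := by
    intro a ha b hb hab
    rw [Finset.mem_coe, Finset.mem_range] at ha hb
    rcases lt_trichotomy a b with h | h | h
    · exact absurd hab (hinj a b h hb)
    · exact h
    · exact absurd hab.symm (hinj b a h ha)
  have := Set.encard_le_encard_of_injOn (s := (Finset.range N : Set ℕ)) (t := s)
    (fun t ht => hf t (by simpa using ht)) hi
  rwa [Set.encard_coe_eq_coe_finsetCard, Finset.card_range] at this

namespace TwoStageRO

variable {nx mx kx nu mu ku ny ky : ℕ} {P : TwoStageRO nx mx kx nu mu ku ny ky}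

/-! ### Duality of the recourse problem -/

theorem demand_dotProduct_le {x : Fin nx ⊕ Fin mx → ℝ} {uc : Fin nu → ℝ} {ud : Fin mu → ℕ}
    {y : Fin ny → ℝ} (hy : y ∈ P.Y x uc ud) {p : Fin ky → ℝ} (hp : 0 ≤ p) :
    P.demand x uc ud ⬝ᵥ p ≤ (P.B2ᵀ *ᵥ p) ⬝ᵥ y := by
  have h1 := dotProduct_le_dotProduct_of_nonneg_right hy.2 hp
  rwa [dotProduct_comm (P.B2 *ᵥ y), dotProduct_mulVec, ← mulVec_transpose] at h1

theorem demand_dotProduct_le_recourseValue (x : Fin nx ⊕ Fin mx → ℝ) (uc : Fin nu → ℝ)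
    (ud : Fin mu → ℕ) {p : Fin ky → ℝ} (hp : p ∈ P.dualSet) :
    ((P.demand x uc ud ⬝ᵥ p : ℝ) : EReal) ≤ P.recourseValue x uc ud :=
  le_iInf₂ fun _ hy => EReal.coe_le_coe_iff.2 <| (demand_dotProduct_le hy hp.1).trans
    (dotProduct_le_dotProduct_of_nonneg_right hp.2 hy.1)

theorem Y_eq_empty_of_ray {x : Fin nx ⊕ Fin mx → ℝ} {uc : Fin nu → ℝ} {ud : Fin mu → ℕ}
    {g : Fin ky → ℝ} (hg : g ∈ P.dualCone) (h : 0 < P.demand x uc ud ⬝ᵥ g) : P.Y x uc ud = ∅ := by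
  refine Set.eq_empty_of_forall_notMem fun y hy => ?_
  have h1 := demand_dotProduct_le hy hg.1
  have h2 := dotProduct_le_dotProduct_of_nonneg_right hg.2 hy.1
  rw [zero_dotProduct] at h2
  linarith

theorem OptimalityCase.etaO_le {x : Fin nx ⊕ Fin mx → ℝ} {uc : Fin nu → ℝ} {ud : Fin mu → ℕ}
    {beta : Fin ky → ℝ} (h : P.OptimalityCase x uc ud beta) :
    P.etaO x ≤ ((P.demand x uc ud ⬝ᵥ beta : ℝ) : EReal) := by
  obtain ⟨-, -, hval, hb, hopt⟩ := h
  obtain ⟨y, hy0, hy1, hy2⟩ := exists_primal_of_dual_optimal P.B2 (P.demand x uc ud) P.c2 beta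
    hb.1.1 hb.1.2 (fun q h0 hq => hopt q ⟨h0, hq⟩)
  rw [← hval]
  exact (iInf₂_le y ⟨hy0, hy1⟩).trans (EReal.coe_le_coe_iff.2 hy2)

/-- Weak duality at `uc'`, worst-case optimality, and strong duality at `uc`, chained through
`etaO`. -/
theorem OptimalityCase.demand_le {x : Fin nx ⊕ Fin mx → ℝ} {uc uc' : Fin nu → ℝ}
    {ud : Fin mu → ℕ} {beta : Fin ky → ℝ} (h : P.OptimalityCase x uc ud beta)
    (hu : uc' ∈ P.USlice x ud) :
    P.demand x uc' ud ⬝ᵥ beta ≤ P.demand x uc ud ⬝ᵥ beta := by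
  rw [← EReal.coe_le_coe_iff]
  refine (demand_dotProduct_le_recourseValue x uc' ud h.2.2.2.1.1).trans (le_trans ?_ h.etaO_le)
  exact le_iSup₂ (f := fun (u : (Fin nu → ℝ) × (Fin mu → ℕ)) (_ : u ∈ P.U x) =>
    P.recourseValue x u.1 u.2) (uc', ud) ⟨h.2.1.1, hu⟩

/-- In the optimality case, the scenario found by `SP2` is the basic solution of every optimal
basis. -/
theorem OptimalityCase.eq_basic {M : ℝ} (hU : P.Uniqueness M) {x : Fin nx ⊕ Fin mx → ℝ}
    (hx : x ∈ P.X) {uc uc' : Fin nu → ℝ} {ud : Fin mu → ℕ} {beta : Fin ky → ℝ}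
    (h : P.OptimalityCase x uc ud beta) {B : Finset (Fin nu ⊕ Fin ku)} {lam : Fin ku → ℝ}
    (hB : P.IsBasisFor x ud B uc') (hlam : P.IsDualMultiplier M beta B lam) : uc' = uc := by
  have hopt := OU.mem_lpOptimal (hB.mem_OU hlam)
  have hfeas : (uc, (0 : Fin ku → ℝ)) ∈ P.lpFeasible x ud :=
    ⟨h.2.1.2.1, le_rfl, by simpa using h.2.1.2.2⟩
  have hle : P.lpObj M beta (uc', 0) ≤ P.lpObj M beta (uc, 0) := by
    have := h.demand_le hB.mem_USlice
    simp only [demand, sub_dotProduct] at this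
    simp only [lpObj, neg_dotProduct]
    linarith
  exact (Prod.ext_iff.1 ((hU x hx ud h.2.1.1 beta (Or.inl h.2.2.2.1)).unique hopt
    ⟨hfeas, fun q hq => (hopt.2 q hq).trans hle⟩)).1

/-! ### Iterations of the algorithm -/

variable {M : ℝ} {T : Trajectory nx mx nu mu ky}

theorem Performs.x_mem {t : ℕ} (h : P.Performs M T t) : T.x t ∈ P.X := by
  obtain ⟨⟨⟨_, h, -⟩, -⟩, -⟩ := h
  exact h

theorem Performs.scenario_mem {t : ℕ} (h : P.Performs M T t) :
    T.ud t ∈ P.Ud ∧ T.uc t ∈ P.USlice (T.x t) (T.ud t) := by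
  rcases h.2 with h | h
  exacts [h.2.1, h.2.1]

theorem Performs.beta_mem {t : ℕ} (h : P.Performs M T t) :
    T.beta t ∈ P.extrPoints ∪ P.extrRays := by
  rcases h.2 with h | h
  exacts [Or.inl h.2.2.2.1, Or.inr h.2.2.2.1]

/-- The basic solution `uc` reproduces the outcome of the subproblems in iteration `t`: it is the
scenario of `SP2`, or the recourse problem is infeasible for it. -/
def Reproduces (P : TwoStageRO nx mx kx nu mu ku ny ky) (T : Trajectory nx mx nu mu ky) (t : ℕ)
    (uc : Fin nu → ℝ) : Prop :=
  (P.OptimalityCase (T.x t) (T.uc t) (T.ud t) (T.beta t) ∧ uc = T.uc t) ∨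
    P.Y (T.x t) uc (T.ud t) = ∅

theorem Performs.reproduces_self {t : ℕ} (h : P.Performs M T t) : P.Reproduces T t (T.uc t) :=
  h.2.imp (fun h => ⟨h, rfl⟩) fun h => Y_eq_empty_of_ray h.2.2.2.1.1 h.2.2.2.2

/-- In the feasibility case the basic solution may differ from the recorded scenario, but it
maximizes the demand along the ray, so the ray still certifies infeasibility. -/
theorem Performs.reproduces_of_basis (hU : P.Uniqueness M) {t : ℕ} (h : P.Performs M T t)
    {B : Finset (Fin nu ⊕ Fin ku)} {uc : Fin nu → ℝ} {lam : Fin ku → ℝ}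
    (hB : P.IsBasisFor (T.x t) (T.ud t) B uc) (hlam : P.IsDualMultiplier M (T.beta t) B lam) :
    P.Reproduces T t uc :=
  h.2.imp (fun h' => ⟨h', h'.eq_basic hU h.x_mem hB hlam⟩) fun h' =>
    Y_eq_empty_of_ray h'.2.2.2.1.1 (h'.2.2.2.2.trans_le (hB.demand_le hlam h'.2.1.2))

/-- If a stored cut enforces, at the current first-stage decision, a scenario that reproduces the
outcome of the subproblems for this decision, then the algorithm terminates. -/
theorem terminatesAt_of_cut (hU : P.Uniqueness M) {r s t : ℕ} (hrt : r < t) (hst : s ≤ t)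
    (hx : T.x s = T.x t) (hud : T.ud r = T.ud s) (hr : P.Performs M T r)
    (ht : P.Performs M T t) {B : Finset (Fin nu ⊕ Fin ku)} {uc : Fin nu → ℝ} {lam : Fin ku → ℝ}
    (hB : P.IsBasisFor (T.x s) (T.ud s) B uc) (hlam : P.IsDualMultiplier M (T.beta r) B lam)
    (hrep : P.Reproduces T s uc) : P.TerminatesAt M T t := by
  -- By uniqueness the cut's KKT point is `(uc, 0)`, so its recourse constraints are active.
  have key : ∀ η, P.MPFeasible M (cuts T t) (T.x t) η →
      ∃ y ∈ P.Y (T.x s) uc (T.ud s), P.c2 ⬝ᵥ y ≤ η := by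
    intro η hη
    obtain ⟨q, hq, y, hy0, hy⟩ := hη.2 (T.ud r, T.beta r) ⟨r, hrt, rfl⟩
    rw [← hx] at hq hy
    simp only [hud] at hq hy
    obtain ⟨h1, h2⟩ := hU.eq_of_mem_OU (hx ▸ ht.x_mem) (hud ▸ hr.scenario_mem.1) hr.beta_mem hB
      hlam hq
    obtain ⟨h3, h4⟩ := hy h2
    exact ⟨y, ⟨hy0, h1 ▸ h4⟩, h3⟩
  rcases hrep with ⟨hopt, rfl⟩ | hemp
  · refine (iInf₂_le s hst).trans (le_iInf₂ fun η hη => ?_)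
    obtain ⟨y, hy, hle⟩ := key η hη
    rw [hx, EReal.coe_add, ← hx]
    refine add_le_add_right (le_trans ?_ (EReal.coe_le_coe_iff.2 hle)) _
    rw [← hopt.2.2.1]
    exact iInf₂_le y hy
  -- This case is impossible: the master problem is feasible at `T.x t`.
  · obtain ⟨η, hη⟩ := ht.1.1
    obtain ⟨y, hy, -⟩ := key η hη
    rw [hemp] at hy
    exact hy.elim

end TwoStageRO

/-! ### The main theorem. -/

theorem mainTheorem8 {nx mx kx nu mu ku ny ky : ℕ} (P : TwoStageRO nx mx kx nu mu ku ny ky)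
    (hA1 : P.AssumptionA1) (hA2 : P.AssumptionA2) (hA3 : P.AssumptionA3) :
    ∃ M₀ : ℝ, ∀ M : ℝ, M₀ ≤ M → P.Uniqueness M → ∀ T : Trajectory nx mx nu mu ky,
      -- every iteration has an associated basis, representing the scenario of SP2 in the optimality case
      (∀ t, P.RunsThrough M T t → P.Performs M T t →
        (∃ B, P.IsOptimalBasis M (T.x t) (T.ud t) (T.beta t) B) ∧
        (P.etaF (T.x t) = 0 → ∀ B, P.IsOptimalBasis M (T.x t) (T.ud t) (T.beta t) B →
          P.IsBasisFor (T.x t) (T.ud t) B (T.uc t))) ∧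
      -- a recurring pair (discrete scenario, basis) makes the algorithm terminate
      (∀ t₁ t₂, t₁ < t₂ → P.RunsThrough M T t₂ → P.Performs M T t₂ → T.ud t₁ = T.ud t₂ →
        (∃ B, P.IsOptimalBasis M (T.x t₁) (T.ud t₁) (T.beta t₁) B ∧
          (P.IsOptimalBasis M (T.x t₂) (T.ud t₂) (T.beta t₂) B ∨
            P.IsBasisFor (T.x t₂) (T.ud t₂) B (T.uc t₂))) →
        P.TerminatesAt M T t₂) ∧
      -- bounds on the number of iterations that end without termination
      (∀ N, P.RunsThrough M T N →
        N ≤ P.Ud.card * (nu + ku).choose ku ∧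
        (N : ℕ∞) ≤ min (min ((P.Ud.card : ℕ∞) * (P.extrPoints.encard + P.extrRays.encard))
          P.X.encard) ((P.Ud.card * (nu + ku).choose ku : ℕ) : ℕ∞) ∧
        (N : ℕ∞) ≤ min (min ((P.Ud.card * (ny + ky + 1).choose ky : ℕ) : ℕ∞)
          P.X.encard) ((P.Ud.card * (nu + ku).choose ku : ℕ) : ℕ∞)) := by
  classical
  obtain ⟨M₀, hM₀⟩ := P.exists_multiplier_bound
  refine ⟨M₀, fun M hM hU T => ?_⟩
  have hbasis : ∀ t, P.Performs M T t → ∃ B uc lam, P.IsBasisFor (T.x t) (T.ud t) B uc ∧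
      P.IsDualMultiplier M (T.beta t) B lam := fun t h =>
    P.exists_basis_of_nonempty hA2 h.x_mem h.scenario_mem.1 ⟨_, h.scenario_mem.2⟩ _
      fun B hB lam hl i => (hM₀ _ h.beta_mem B hB lam hl i).trans hM
  have hrec : ∀ t₁ t₂, t₁ < t₂ → P.RunsThrough M T t₂ → P.Performs M T t₂ → T.ud t₁ = T.ud t₂ →
      (∃ B, P.IsOptimalBasis M (T.x t₁) (T.ud t₁) (T.beta t₁) B ∧
        (P.IsOptimalBasis M (T.x t₂) (T.ud t₂) (T.beta t₂) B ∨
          P.IsBasisFor (T.x t₂) (T.ud t₂) B (T.uc t₂))) → P.TerminatesAt M T t₂ := by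
    rintro t₁ t₂ hlt hrun hp₂ hud ⟨B, ⟨-, lam₁, hlam₁⟩, ⟨⟨uc, hB⟩, lam₂, hlam₂⟩ | hB⟩
    · exact TwoStageRO.terminatesAt_of_cut hU hlt le_rfl rfl hud (hrun t₁ hlt).1 hp₂ hB hlam₁
        (hp₂.reproduces_of_basis hU hB hlam₂)
    · exact TwoStageRO.terminatesAt_of_cut hU hlt le_rfl rfl hud (hrun t₁ hlt).1 hp₂ hB hlam₁
        hp₂.reproduces_self
  refine ⟨fun t _ hp => ⟨?_, ?_⟩, hrec, fun N hN => ?_⟩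
  · obtain ⟨B, uc, lam, hB, hlam⟩ := hbasis t hp
    exact ⟨B, ⟨uc, hB⟩, lam, hlam⟩
  · rintro h0 B ⟨⟨uc, hB⟩, lam, hlam⟩
    rcases hp.2 with h | h
    · exact h.eq_basic hU hp.x_mem hB hlam ▸ hB
    · exact absurd h0 h.1.ne'
  have hrun : ∀ t < N, P.RunsThrough M T t := fun t ht s hs => hN s (hs.trans ht)
  have hbasisCount : (N : ℕ∞) ≤ ((P.Ud.card * (nu + ku).choose ku : ℕ) : ℕ∞) := by
    choose! B uc lam hB using hbasis
    have := natCast_le_encard_of_injOn (fun t => (T.ud t, B t))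
      (s := ((P.Ud ×ˢ Finset.powersetCard ku Finset.univ :
        Finset ((Fin mu → ℕ) × Finset (Fin nu ⊕ Fin ku))) : Set _))
      (fun t ht => by
        have h := (hN t ht).1
        simp [h.scenario_mem.1, (hB t h).1.1.1])
      (fun t₁ t₂ hlt h₂ he => by
        have hp₁ := (hN t₁ (hlt.trans h₂)).1
        have hp₂ := (hN t₂ h₂).1
        obtain ⟨hud, hBe⟩ := Prod.ext_iff.1 he
        dsimp only at hud hBe
        refine (hN t₂ h₂).2 (hrec t₁ t₂ hlt (hrun t₂ h₂) hp₂ hud ⟨B t₁,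
          ⟨⟨_, (hB t₁ hp₁).1⟩, _, (hB t₁ hp₁).2⟩, Or.inl ?_⟩)
        rw [hBe]
        exact ⟨⟨_, (hB t₂ hp₂).1⟩, _, (hB t₂ hp₂).2⟩)
    rwa [Set.encard_coe_eq_coe_finsetCard, Finset.card_product, Finset.card_powersetCard,
      Finset.card_univ, Fintype.card_sum, Fintype.card_fin, Fintype.card_fin] at this
  have hXCount : (N : ℕ∞) ≤ P.X.encard :=
    natCast_le_encard_of_injOn T.x (fun t ht => (hN t ht).1.x_mem) fun t₁ t₂ hlt h₂ he => by
      have hp₁ := (hN t₁ (hlt.trans h₂)).1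
      obtain ⟨B, uc, lam, hB, hlam⟩ := hbasis t₁ hp₁
      -- For a repeated `x`, the cut and the reproduced outcome both come from `t₁`.
      exact (hN t₂ h₂).2 (TwoStageRO.terminatesAt_of_cut hU hlt hlt.le he rfl hp₁ (hN t₂ h₂).1 hB hlam
        (hp₁.reproduces_of_basis hU hB hlam))
  have hbetaCount : (N : ℕ∞) ≤ (P.Ud.card : ℕ∞) * (P.extrPoints ∪ P.extrRays).encard := by
    have := natCast_le_encard_of_injOn (fun t => (T.ud t, T.beta t))
      (s := (P.Ud : Set (Fin mu → ℕ)) ×ˢ (P.extrPoints ∪ P.extrRays))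
      (fun t ht => ⟨(hN t ht).1.scenario_mem.1, (hN t ht).1.beta_mem⟩)
      (fun t₁ t₂ hlt h₂ he => by
        have hp₂ := (hN t₂ h₂).1
        obtain ⟨hud, hbe⟩ := Prod.ext_iff.1 he
        dsimp only at hud hbe
        obtain ⟨B, uc, lam, hB, hlam⟩ := hbasis t₂ hp₂
        -- As `beta` repeats, the multipliers found at `t₂` also serve the cut stored at `t₁`.
        exact (hN t₂ h₂).2 (TwoStageRO.terminatesAt_of_cut hU hlt le_rfl rfl hud (hN t₁ (hlt.trans h₂)).1
          hp₂ hB (hbe ▸ hlam) (hp₂.reproduces_of_basis hU hB hlam)))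
    rwa [Set.encard_prod, Set.encard_coe_eq_coe_finsetCard] at this
  refine ⟨by exact_mod_cast hbasisCount, le_min (le_min ?_ hXCount) hbasisCount,
    le_min (le_min ?_ hXCount) hbasisCount⟩
  · exact hbetaCount.trans (mul_le_mul_right (Set.encard_union_le _ _) _)
  · refine hbetaCount.trans ?_
    rw [Nat.cast_mul]
    exact mul_le_mul_right P.encard_extrPoints_union_extrRays_le _
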